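/- Let $\mathbb F$ be $\mathbb R$ or $\mathbb C$, let $H$ and $K$ be Hilbert spaces over $\mathbb F$, let $\mathscr B(H,K)$ be the space of bounded $\mathbb F$-linear operators from $H$ to $K$ with the operator norm, and let $\mathscr K(H,K)\subseteq\mathscr B(H,K)$ be the subspace of compact operators. Let $A\in\mathscr B(H,K)$ be such that $$\operatorname{dist}(A,\mathscr K(H,K))=\inf\{\|A-T\| : T\in\mathscr K(H,K)\}<\|A\|,$$ and let $B\in\mathscr B(H,K)$. Then $A$ is Birkhoff–James orthogonal to $B$, that is, $\|A\|\le\|A+\lambda B\|$ for all $\lambda\in\mathbb F$, if and only if there exists a sequence of unit vectors $u_n\in H$ such that $\|Au_n\|=\|A\|$ for all $n\in\mathbb N$ and $\lim_{n\to\infty}\langle Au_n\mid Bu_n\rangle=0$. -/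

import Mathlib

/-- A vector `v` of a normed space over `𝕜` is Birkhoff-James orthogonal to the subspace `W` if
`‖v‖ ≤ ‖v + w‖` for all `w ∈ W`. -/
def BJOrthogonalToSubspace {𝕜 V : Type*} [RCLike 𝕜] [NormedAddCommGroup V] [NormedSpace 𝕜 V]
    (v : V) (W : Submodule 𝕜 V) : Prop :=
  ∀ w ∈ W, ‖v‖ ≤ ‖v + w‖

/-- `v` is Birkhoff-James orthogonal to the vector `u` if it is Birkhoff-James orthogonal to the
subspace `𝕜 u`. -/
def BJOrthogonal (𝕜 : Type*) {V : Type*} [RCLike 𝕜] [NormedAddCommGroup V] [NormedSpace 𝕜 V]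
    (v u : V) : Prop :=
  BJOrthogonalToSubspace v (Submodule.span 𝕜 {u})

open Filter Topology

/-! The unit vectors where `A` attains its norm are those of the eigenspace `ker (‖A‖² - A* A)`, so
by Toeplitz-Hausdorff their values `⟪A u, B u⟫ = ⟪u, A* B u⟫` form a convex set `W`. Orthogonality
applied to multiples `c B` puts a point of `W` in every half-plane `re (c z) ≤ 0`: near-maximizers
of `A - t c B` converge along a subsequence as `t → 0`, by the distance hypothesis. Hence `0 ∈
closure W`. The converse pairs `A uₙ` with `(A + c B) uₙ`. -/

/-- Normalized core of the Toeplitz-Hausdorff theorem. -/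
theorem exists_unit_inner_self_apply_eq_ofReal {𝕜 H : Type*} [RCLike 𝕜]
    [NormedAddCommGroup H] [InnerProductSpace 𝕜 H] (E : Submodule 𝕜 H) (T : H →L[𝕜] H) {u v : H}
    (hu : u ∈ E) (hv : v ∈ E) (hu1 : ‖u‖ = 1) (hv1 : ‖v‖ = 1)
    (hTu : inner 𝕜 u (T u) = 0) (hTv : inner 𝕜 v (T v) = 1) {s : ℝ} (hs0 : 0 ≤ s) (hs1 : s ≤ 1) :
    ∃ x ∈ E, ‖x‖ = 1 ∧ inner 𝕜 x (T x) = (s : 𝕜) := by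
  -- This phase makes the cross terms real on the segment from `u` to `γ v`, so the intermediate
  -- value theorem applies there.
  obtain ⟨γ, hγ1, hγ⟩ : ∃ γ : 𝕜, ‖γ‖ = 1 ∧
      RCLike.im (γ * (inner 𝕜 u (T v) - starRingEnd 𝕜 (inner 𝕜 v (T u)))) = 0 := by
    set d := inner 𝕜 u (T v) - starRingEnd 𝕜 (inner 𝕜 v (T u))
    by_cases hd : d = 0
    · exact ⟨1, by simp, by simp [hd]⟩
    · have hd' : ((‖d‖ : ℝ) : 𝕜) ≠ 0 := by simpa using hd
      refine ⟨starRingEnd 𝕜 d / (‖d‖ : 𝕜), ?_, ?_⟩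
      · rw [norm_div, RCLike.norm_conj, RCLike.norm_ofReal, abs_norm]
        exact div_self (norm_ne_zero_iff.2 hd)
      · rw [div_mul_eq_mul_div, RCLike.conj_mul, ← RCLike.ofReal_pow, ← RCLike.ofReal_div]
        exact RCLike.ofReal_im _
  have hγγ : starRingEnd 𝕜 γ * γ = 1 := by rw [RCLike.conj_mul, hγ1]; simp
  let x : ℝ → H := fun t => ((1 - t : ℝ) : 𝕜) • u + ((t : ℝ) : 𝕜) • (γ • v)
  have hxE (t : ℝ) : x t ∈ E := E.add_mem (E.smul_mem _ hu) (E.smul_mem _ (E.smul_mem _ hv))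
  have hxc : Continuous x := by
    have h := RCLike.continuous_ofReal (K := 𝕜)
    exact ((h.comp (by fun_prop : Continuous fun t : ℝ => 1 - t)).smul continuous_const).add
      (h.smul continuous_const)
  have hγv : inner 𝕜 (γ • v) (T (γ • v)) = 1 := by
    rw [map_smul, inner_smul_left, inner_smul_right, hTv, mul_one, hγγ]
  have him (t : ℝ) : RCLike.im (inner 𝕜 (x t) (T (x t))) = 0 := by
    have key : inner 𝕜 (x t) (T (x t)) = ((t ^ 2 : ℝ) : 𝕜) + (((1 - t) * t : ℝ) : 𝕜) *
        (γ * inner 𝕜 u (T v) + starRingEnd 𝕜 γ * inner 𝕜 v (T u)) := by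
      simp only [x, map_add, map_smul, inner_add_left, inner_add_right, inner_smul_left,
        inner_smul_right, hTu, hTv, RCLike.conj_ofReal]
      push_cast
      linear_combination ((t : 𝕜) ^ 2) * hγγ
    rw [key, map_add, RCLike.ofReal_im, zero_add, RCLike.im_ofReal_mul]
    have : RCLike.im (γ * inner 𝕜 u (T v) + starRingEnd 𝕜 γ * inner 𝕜 v (T u)) = 0 := by
      rw [← hγ]
      simp only [map_add, map_sub, RCLike.mul_im, RCLike.conj_re, RCLike.conj_im]
      ring
    rw [this, mul_zero]
  -- The segment could meet `0` only at its midpoint, with `u = -γ v`; the form would then agree at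
  -- `u` and `v`, yet it is `0` and `1`.
  have hx0 (t : ℝ) (ht : t ∈ Set.Icc (0 : ℝ) 1) : x t ≠ 0 := by
    intro h
    have h1 : ((1 - t : ℝ) : 𝕜) • u = -(((t : ℝ) : 𝕜) • (γ • v)) := eq_neg_of_add_eq_zero_left h
    have h2 := congrArg norm h1
    rw [norm_neg, norm_smul, norm_smul, norm_smul, hu1, hv1, hγ1, RCLike.norm_ofReal,
      RCLike.norm_ofReal, abs_of_nonneg (sub_nonneg.2 ht.2), abs_of_nonneg ht.1] at h2
    have ht' : t = 1 / 2 := by linarith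
    subst ht'
    have h3 : u = -(γ • v) := by
      have hne : ((1 / 2 : ℝ) : 𝕜) ≠ 0 := by
        rw [Ne, RCLike.ofReal_eq_zero]; norm_num
      rw [← smul_neg, show (1 - 1 / 2 : ℝ) = 1 / 2 by norm_num] at h1
      exact smul_right_injective H hne h1
    rw [h3, map_neg, inner_neg_neg, hγv] at hTu
    exact one_ne_zero hTu
  let g : ℝ → ℝ := fun t => RCLike.re (inner 𝕜 (x t) (T (x t))) - s * ‖x t‖ ^ 2
  have hgc : Continuous g := by
    have h1 : Continuous fun t => inner 𝕜 (x t) (T (x t)) := hxc.inner (T.continuous.comp hxc)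
    exact (RCLike.continuous_re.comp h1).sub (continuous_const.mul (hxc.norm.pow 2))
  have hg0 : g 0 ≤ 0 := by simp [g, x, hTu, hu1, hs0]
  have hg1 : 0 ≤ g 1 := by
    have : x 1 = γ • v := by simp [x]
    simp only [g, this, hγv, norm_smul, hγ1, hv1, RCLike.one_re]
    linarith
  obtain ⟨t, ht, hgt⟩ := intermediate_value_Icc zero_le_one hgc.continuousOn ⟨hg0, hg1⟩
  have hn : ‖x t‖ ≠ 0 := norm_ne_zero_iff.2 (hx0 t ht)
  have hval : inner 𝕜 (x t) (T (x t)) = ((s * ‖x t‖ ^ 2 : ℝ) : 𝕜) := by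
    refine RCLike.ext ?_ ?_
    · rw [RCLike.ofReal_re]; exact sub_eq_zero.1 hgt
    · rw [RCLike.ofReal_im, him]
  refine ⟨((‖x t‖⁻¹ : ℝ) : 𝕜) • x t, E.smul_mem _ (hxE t), ?_, ?_⟩
  · rw [norm_smul, RCLike.norm_ofReal, abs_inv, abs_norm, inv_mul_cancel₀ hn]
  · rw [map_smul, inner_smul_left, inner_smul_right, hval, RCLike.conj_ofReal,
      ← RCLike.ofReal_mul, ← RCLike.ofReal_mul]
    congr 1
    field_simp

/-- **Toeplitz-Hausdorff theorem**: the numerical range of an operator over the unit sphere of a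
subspace is convex. -/
theorem convex_numericalRange_submodule {𝕜 H : Type*} [RCLike 𝕜]
    [NormedAddCommGroup H] [InnerProductSpace 𝕜 H] (E : Submodule 𝕜 H) (T : H →L[𝕜] H) :
    Convex ℝ {z : 𝕜 | ∃ x ∈ E, ‖x‖ = 1 ∧ inner 𝕜 x (T x) = z} := by
  rintro p ⟨u, hu, hu1, hp⟩ r ⟨v, hv, hv1, hr⟩ a s ha hs has
  by_cases hpr : p = r
  · subst hpr
    rw [← add_smul, has, one_smul]
    exact ⟨u, hu, hu1, hp⟩
  have hd : r - p ≠ 0 := sub_ne_zero.2 (Ne.symm hpr)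
  let T' : H →L[𝕜] H := (r - p)⁻¹ • (T - p • ContinuousLinearMap.id 𝕜 H)
  have hT' (y : H) (hy : ‖y‖ = 1) : inner 𝕜 y (T' y) = (r - p)⁻¹ * (inner 𝕜 y (T y) - p) := by
    simp [T', inner_smul_right, inner_sub_right, inner_self_eq_norm_sq_to_K, hy]
  obtain ⟨x, hx, hx1, hxs⟩ := exists_unit_inner_self_apply_eq_ofReal E T' hu hv hu1 hv1
    (by rw [hT' u hu1, hp, sub_self, mul_zero]) (by rw [hT' v hv1, hr, inv_mul_cancel₀ hd])
    hs (by linarith)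
  refine ⟨x, hx, hx1, ?_⟩
  rw [hT' x hx1, inv_mul_eq_iff_eq_mul₀ hd] at hxs
  have ha' : a = 1 - s := by linarith
  rw [sub_eq_iff_eq_add.1 hxs, ha', RCLike.real_smul_eq_coe_mul, RCLike.real_smul_eq_coe_mul]
  push_cast
  ring

/-! ### Norm-attaining vectors and norming sequences -/

section NormAttainment

variable {𝕜 H K : Type*} [RCLike 𝕜]
  [NormedAddCommGroup H] [InnerProductSpace 𝕜 H] [CompleteSpace H]
  [NormedAddCommGroup K] [InnerProductSpace 𝕜 K] [CompleteSpace K]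

/-- Expand the square and use `‖A* A u‖ ≤ ‖A‖ ‖A u‖`. Near-maximizers are thus approximate
eigenvectors of `A* A`. -/
theorem norm_sq_smul_sub_adjoint_apply_sq_le (A : H →L[𝕜] K) {u : H} (hu : ‖u‖ = 1) :
    ‖((‖A‖ ^ 2 : ℝ) : 𝕜) • u - A.adjoint (A u)‖ ^ 2 ≤ ‖A‖ ^ 2 * (‖A‖ ^ 2 - ‖A u‖ ^ 2) := by
  have h1 : RCLike.re (inner 𝕜 (((‖A‖ ^ 2 : ℝ) : 𝕜) • u) (A.adjoint (A u))) =
      ‖A‖ ^ 2 * ‖A u‖ ^ 2 := by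
    rw [inner_smul_left, ContinuousLinearMap.adjoint_inner_right, RCLike.conj_ofReal,
      RCLike.re_ofReal_mul, inner_self_eq_norm_sq]
  have h2 : ‖A.adjoint (A u)‖ ≤ ‖A‖ * ‖A u‖ := by
    simpa using A.adjoint.le_opNorm (A u)
  have h3 : ‖A.adjoint (A u)‖ ^ 2 ≤ (‖A‖ * ‖A u‖) ^ 2 := by gcongr
  rw [@norm_sub_sq 𝕜, h1, norm_smul, hu, RCLike.norm_ofReal, abs_of_nonneg (by positivity)]
  linarith

/-- The space on which an operator attains its norm. -/
noncomputable def normAttainingSubmodule (A : H →L[𝕜] K) : Submodule 𝕜 H :=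
  LinearMap.ker (((‖A‖ ^ 2 : ℝ) : 𝕜) • ContinuousLinearMap.id 𝕜 H - A.adjoint ∘L A).toLinearMap

theorem mem_normAttainingSubmodule_iff (A : H →L[𝕜] K) {u : H} (hu : ‖u‖ = 1) :
    u ∈ normAttainingSubmodule A ↔ ‖A u‖ = ‖A‖ := by
  have hmem : u ∈ normAttainingSubmodule A ↔
      ((‖A‖ ^ 2 : ℝ) : 𝕜) • u - A.adjoint (A u) = 0 := by
    simp [normAttainingSubmodule]
  rw [hmem]
  constructor
  · intro h
    have h1 : inner 𝕜 (A.adjoint (A u)) u = inner 𝕜 (((‖A‖ ^ 2 : ℝ) : 𝕜) • u) u := by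
      rw [sub_eq_zero.1 h]
    rw [ContinuousLinearMap.adjoint_inner_left, inner_smul_left, inner_self_eq_norm_sq_to_K,
      inner_self_eq_norm_sq_to_K, hu, RCLike.conj_ofReal, RCLike.ofReal_one, one_pow, mul_one,
      ← RCLike.ofReal_pow, RCLike.ofReal_inj] at h1
    exact (sq_eq_sq₀ (norm_nonneg _) (norm_nonneg _)).1 h1
  · intro h
    have h1 := norm_sq_smul_sub_adjoint_apply_sq_le A hu
    rw [h, sub_self, mul_zero] at h1
    exact norm_eq_zero.1 (pow_eq_zero_iff two_ne_zero |>.1 (le_antisymm h1 (sq_nonneg _)))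

/-- If the distance of `A` to the compact operators is less than `‖A‖`, then every norming
sequence of unit vectors has a convergent subsequence. -/
theorem exists_tendsto_subseq_of_norming (A : H →L[𝕜] K)
    (hA : Metric.infDist A {T : H →L[𝕜] K | IsCompactOperator T} < ‖A‖)
    (u : ℕ → H) (hu : ∀ n, ‖u n‖ = 1) (hAu : Tendsto (fun n => ‖A (u n)‖) atTop (𝓝 ‖A‖)) :
    ∃ (x : H) (φ : ℕ → ℕ), StrictMono φ ∧ Tendsto (u ∘ φ) atTop (𝓝 x) := by
  obtain ⟨T, hT, hTA⟩ := (Metric.infDist_lt_iff ⟨0, isCompactOperator_zero⟩).1 hA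
  have hApos : 0 < ‖A‖ := Metric.infDist_nonneg.trans_lt hA
  rw [dist_eq_norm] at hTA
  have hc : 0 < ‖A‖ * (‖A‖ - ‖A - T‖) := mul_pos hApos (sub_pos.2 hTA)
  have hS : IsCompactOperator (A.adjoint ∘L T) := hT.clm_comp A.adjoint
  obtain ⟨C, hC, hCS⟩ := hS.image_closedBall_subset_compact 1
  obtain ⟨y, -, φ, hφ, hy⟩ := hC.tendsto_subseq (x := fun n => (A.adjoint ∘L T) (u n))
    fun n => hCS ⟨u n, by simp [hu n], rfl⟩
  have hD : Tendsto (fun n => ((‖A‖ ^ 2 : ℝ) : 𝕜) • u n - A.adjoint (A (u n))) atTop (𝓝 0) := by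
    have hsq : Tendsto (fun n => ‖A‖ ^ 2 * (‖A‖ ^ 2 - ‖A (u n)‖ ^ 2)) atTop (𝓝 0) := by
      have h0 : ‖A‖ ^ 2 * (‖A‖ ^ 2 - ‖A‖ ^ 2) = 0 := by ring
      exact h0 ▸ ((tendsto_const_nhds (x := ‖A‖ ^ 2)).sub (hAu.pow 2)).const_mul (‖A‖ ^ 2)
    have := squeeze_zero (fun n => sq_nonneg _)
      (fun n => norm_sq_smul_sub_adjoint_apply_sq_le A (hu n)) hsq
    rw [tendsto_zero_iff_norm_tendsto_zero]
    simpa [Real.sqrt_sq] using this.sqrt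
  -- `Q = (‖A‖² - A* A) + A* T`: the first term tends to `0` on `u n`, the second converges along
  -- `φ`. As `‖A - T‖ < ‖A‖`, `Q` is bounded below, so `u ∘ φ` is Cauchy.
  let Q : H →L[𝕜] H := ((‖A‖ ^ 2 : ℝ) : 𝕜) • ContinuousLinearMap.id 𝕜 H - A.adjoint ∘L (A - T)
  have hQ (x : H) : ‖A‖ * (‖A‖ - ‖A - T‖) * ‖x‖ ≤ ‖Q x‖ := by
    have h1 : ‖A.adjoint ((A - T) x)‖ ≤ ‖A‖ * (‖A - T‖ * ‖x‖) := by
      refine (A.adjoint.le_opNorm _).trans ?_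
      rw [LinearIsometryEquiv.norm_map]
      gcongr
      exact (A - T).le_opNorm x
    have h2 : ‖((‖A‖ ^ 2 : ℝ) : 𝕜) • x‖ = ‖A‖ ^ 2 * ‖x‖ := by
      rw [norm_smul, RCLike.norm_ofReal, abs_of_nonneg (by positivity)]
    have h3 := norm_sub_norm_le (((‖A‖ ^ 2 : ℝ) : 𝕜) • x) (A.adjoint ((A - T) x))
    have h4 : Q x = ((‖A‖ ^ 2 : ℝ) : 𝕜) • x - A.adjoint ((A - T) x) := rfl
    rw [h4]
    linarith
  have hQu : Tendsto (fun n => Q (u (φ n))) atTop (𝓝 y) := by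
    have h := (hD.comp hφ.tendsto_atTop).add hy
    rw [zero_add] at h
    refine h.congr fun n => ?_
    simp only [Q, Function.comp_apply, ContinuousLinearMap.comp_apply, sub_apply, smul_apply,
      ContinuousLinearMap.id_apply, map_sub]
    abel
  have hcau : CauchySeq (u ∘ φ) := by
    have hanti : AntilipschitzWith (Real.toNNReal (‖A‖ * (‖A‖ - ‖A - T‖)))⁻¹ Q := by
      refine ContinuousLinearMap.antilipschitz_of_bound Q fun x => ?_
      rw [NNReal.coe_inv, Real.coe_toNNReal _ hc.le, inv_mul_eq_div, le_div_iff₀ hc, mul_comm]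
      exact hQ x
    exact (hanti.isUniformInducing Q.uniformContinuous).cauchy_map_iff.1 (by
      rw [Filter.map_map]
      exact hQu.cauchySeq)
  obtain ⟨x, hx⟩ := cauchySeq_tendsto_of_complete hcau
  exact ⟨x, φ, hφ, hx⟩

theorem exists_unit_norm_apply_gt {E F : Type*} [NormedAddCommGroup E] [NormedSpace 𝕜 E]
    [NormedAddCommGroup F] [NormedSpace 𝕜 F] (C : E →L[𝕜] F) {r : ℝ} (hr0 : 0 ≤ r)
    (hr : r < ‖C‖) : ∃ u : E, ‖u‖ = 1 ∧ r < ‖C u‖ := by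
  by_contra! h
  refine hr.not_ge (C.opNorm_le_bound hr0 fun x => ?_)
  by_cases hx : x = 0
  · simp [hx]
  have hn : ‖x‖ ≠ 0 := norm_ne_zero_iff.2 hx
  have h1 := h (((‖x‖⁻¹ : ℝ) : 𝕜) • x) (by
    rw [norm_smul, RCLike.norm_ofReal, abs_inv, abs_norm, inv_mul_cancel₀ hn])
  rwa [map_smul, norm_smul, RCLike.norm_ofReal, abs_inv, abs_norm, inv_mul_le_iff₀ (by positivity),
    mul_comm] at h1

/-- If subtracting small positive multiples of `B` does not decrease the norm of `A`, then
`re ⟪A u, B u⟫ ≤ 0` at some unit vector where `A` attains its norm. -/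
theorem exists_normAttaining_re_inner_nonpos (A B : H →L[𝕜] K)
    (hA : Metric.infDist A {T : H →L[𝕜] K | IsCompactOperator T} < ‖A‖)
    (h : ∀ t : ℝ, ‖A‖ ≤ ‖A - (t : 𝕜) • B‖) :
    ∃ u : H, ‖u‖ = 1 ∧ ‖A u‖ = ‖A‖ ∧ RCLike.re (inner 𝕜 (A u) (B u)) ≤ 0 := by
  have hApos : 0 < ‖A‖ := Metric.infDist_nonneg.trans_lt hA
  obtain ⟨t, -, ht, htend⟩ := exists_seq_strictAnti_tendsto' (lt_min hApos one_pos)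
  have ht0 (n : ℕ) : 0 < t n := (ht n).1
  have htA (n : ℕ) : t n < ‖A‖ := (ht n).2.trans_le (min_le_left _ _)
  have ht1 (n : ℕ) : t n < 1 := (ht n).2.trans_le (min_le_right _ _)
  -- The slack `t n ^ 2` is of second order, so it still vanishes after the division by `t n` in
  -- `hre`.
  have hex (n : ℕ) : ∃ u : H, ‖u‖ = 1 ∧ ‖A‖ - t n ^ 2 < ‖(A - (t n : 𝕜) • B) u‖ := by
    refine exists_unit_norm_apply_gt _ ?_ ?_
    · nlinarith [ht0 n, htA n, ht1 n]
    · have := h (t n)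
      have := pow_pos (ht0 n) 2
      linarith
  choose u hu hbig using hex
  have hBu (n : ℕ) : ‖B (u n)‖ ≤ ‖B‖ := by simpa [hu n] using B.le_opNorm (u n)
  have hAu (n : ℕ) : ‖A (u n)‖ ≤ ‖A‖ := by simpa [hu n] using A.le_opNorm (u n)
  have happ (n : ℕ) : (A - (t n : 𝕜) • B) (u n) = A (u n) - (t n : 𝕜) • B (u n) := rfl
  have hns (n : ℕ) : ‖(t n : 𝕜) • B (u n)‖ = t n * ‖B (u n)‖ := by
    rw [norm_smul, RCLike.norm_ofReal, abs_of_pos (ht0 n)]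
  have hlim : Tendsto (fun n => ‖A (u n)‖) atTop (𝓝 ‖A‖) := by
    have hl : Tendsto (fun n => ‖A‖ - t n ^ 2 - t n * ‖B‖) atTop (𝓝 ‖A‖) := by
      simpa using ((tendsto_const_nhds (x := ‖A‖)).sub (htend.pow 2)).sub (htend.mul_const ‖B‖)
    refine tendsto_of_tendsto_of_tendsto_of_le_of_le hl tendsto_const_nhds (fun n => ?_) hAu
    have h1 := norm_sub_le (A (u n)) ((t n : 𝕜) • B (u n))
    rw [← happ, hns] at h1
    have h2 := mul_le_mul_of_nonneg_left (hBu n) (ht0 n).le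
    have h3 := hbig n
    dsimp only
    linarith
  have hre (n : ℕ) : RCLike.re (inner 𝕜 (A (u n)) (B (u n))) ≤ t n * (‖B‖ ^ 2 + 2 * ‖A‖) := by
    have h1 : (‖A‖ - t n ^ 2) ^ 2 ≤ ‖(A - (t n : 𝕜) • B) (u n)‖ ^ 2 := by
      refine pow_le_pow_left₀ ?_ (hbig n).le 2
      nlinarith [ht0 n, htA n, ht1 n]
    rw [happ, @norm_sub_sq 𝕜, inner_smul_right, RCLike.re_ofReal_mul, hns] at h1
    have h2 : ‖A (u n)‖ ^ 2 ≤ ‖A‖ ^ 2 := by gcongr; exact hAu n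
    have h3 : (t n * ‖B (u n)‖) ^ 2 ≤ (t n * ‖B‖) ^ 2 := by
      have := ht0 n
      gcongr
      exact hBu n
    have h4 : t n * (2 * RCLike.re (inner 𝕜 (A (u n)) (B (u n)))) ≤
        t n * (t n * (‖B‖ ^ 2 + 2 * ‖A‖)) := by
      nlinarith [sq_nonneg (t n ^ 2)]
    have h5 := le_of_mul_le_mul_left h4 (ht0 n)
    have h6 : 0 ≤ t n * (‖B‖ ^ 2 + 2 * ‖A‖) := by
      have := ht0 n
      positivity
    linarith
  obtain ⟨x, φ, hφ, hx⟩ := exists_tendsto_subseq_of_norming A hA u hu hlim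
  have hAx := (A.continuous.tendsto x).comp hx
  have hBx := (B.continuous.tendsto x).comp hx
  refine ⟨x, ?_, ?_, ?_⟩
  · exact tendsto_nhds_unique hx.norm (by simp [hu])
  · exact tendsto_nhds_unique hAx.norm (hlim.comp hφ.tendsto_atTop)
  · have h1 := (RCLike.continuous_re.tendsto _).comp (hAx.inner (𝕜 := 𝕜) hBx)
    have h2 : Tendsto (fun n => t (φ n) * (‖B‖ ^ 2 + 2 * ‖A‖)) atTop (𝓝 0) := by
      simpa using (htend.comp hφ.tendsto_atTop).mul_const (‖B‖ ^ 2 + 2 * ‖A‖)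
    exact le_of_tendsto_of_tendsto' h1 h2 fun n => hre (φ n)

end NormAttainment

/-! ### Separation and the characterization of orthogonality -/

theorem bjOrthogonal_iff_forall_smul {𝕜 V : Type*} [RCLike 𝕜] [NormedAddCommGroup V]
    [NormedSpace 𝕜 V] (v u : V) : BJOrthogonal 𝕜 v u ↔ ∀ c : 𝕜, ‖v‖ ≤ ‖v + c • u‖ := by
  constructor
  · exact fun h c => h _ (Submodule.smul_mem _ _ (Submodule.mem_span_singleton_self u))
  · intro h w hw
    obtain ⟨c, rfl⟩ := Submodule.mem_span_singleton.1 hw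
    exact h c

/-- A convex set of scalars that meets every half-plane `re (c * z) ≤ 0` has `0` in its closure. -/
theorem zero_mem_closure_of_convex_of_forall_re_mul_nonpos {𝕜 : Type*} [RCLike 𝕜] {W : Set 𝕜}
    (hW : Convex ℝ W) (h : ∀ c : 𝕜, ∃ z ∈ W, RCLike.re (c * z) ≤ 0) : (0 : 𝕜) ∈ closure W := by
  obtain ⟨z₀, hz₀, -⟩ := h 0
  obtain ⟨w, hw, hmin⟩ := exists_norm_eq_iInf_of_complete_convex (K := closure W)
    ⟨z₀, subset_closure hz₀⟩ isClosed_closure.isComplete hW.closure (0 : 𝕜)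
  have hobt := (norm_eq_iInf_iff_real_inner_le_zero hW.closure hw).1 hmin
  -- The point `w` of the closure nearest to `0` satisfies `‖w‖² ≤ re (conj w * z)` on `W`; the
  -- half-plane for `conj w` forces `w = 0`.
  obtain ⟨z, hz, hre⟩ := h (starRingEnd 𝕜 w)
  have h1 := hobt z (subset_closure hz)
  change RCLike.re (inner 𝕜 (0 - w) (z - w)) ≤ 0 at h1
  rw [zero_sub, inner_neg_left, inner_sub_right, map_neg, map_sub,
    inner_self_eq_norm_sq, RCLike.inner_apply'] at h1
  have h2 : ‖w‖ ^ 2 ≤ 0 := by linarith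
  have h3 : w = 0 := norm_eq_zero.1 (pow_eq_zero_iff two_ne_zero |>.1 (le_antisymm h2 (sq_nonneg _)))
  exact h3 ▸ hw

theorem mainTheorem8 {𝕜 H K : Type*} [RCLike 𝕜]
    [NormedAddCommGroup H] [InnerProductSpace 𝕜 H] [CompleteSpace H]
    [NormedAddCommGroup K] [InnerProductSpace 𝕜 K] [CompleteSpace K]
    (A : H →L[𝕜] K)
    (hA : Metric.infDist A {T : H →L[𝕜] K | IsCompactOperator T} < ‖A‖)
    (B : H →L[𝕜] K) :
    BJOrthogonal 𝕜 A B ↔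
      ∃ u : ℕ → H, (∀ n, ‖u n‖ = 1) ∧ (∀ n, ‖A (u n)‖ = ‖A‖) ∧
        Filter.Tendsto (fun n => inner 𝕜 (A (u n)) (B (u n))) Filter.atTop (nhds 0) := by

  have hApos : 0 < ‖A‖ := Metric.infDist_nonneg.trans_lt hA
  rw [bjOrthogonal_iff_forall_smul]
  constructor
  · intro h
    let W : Set 𝕜 :=
      {z | ∃ x ∈ normAttainingSubmodule A, ‖x‖ = 1 ∧ inner 𝕜 x ((A.adjoint ∘L B) x) = z}
    have hW : (0 : 𝕜) ∈ closure W := by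
      refine zero_mem_closure_of_convex_of_forall_re_mul_nonpos
        (convex_numericalRange_submodule _ _) fun c => ?_
      obtain ⟨u, hu1, hu2, hu3⟩ := exists_normAttaining_re_inner_nonpos A (c • B) hA fun t => by
        simpa [smul_smul, sub_eq_add_neg] using h (-(t * c))
      refine ⟨_, ⟨u, (mem_normAttainingSubmodule_iff A hu1).2 hu2, hu1, rfl⟩, ?_⟩
      rw [ContinuousLinearMap.comp_apply, ContinuousLinearMap.adjoint_inner_right]
      rwa [smul_apply, inner_smul_right] at hu3
    obtain ⟨z, hz, hz0⟩ := mem_closure_iff_seq_limit.1 hW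
    choose u huE hu1 huz using hz
    refine ⟨u, hu1, fun n => (mem_normAttainingSubmodule_iff A (hu1 n)).1 (huE n), ?_⟩
    refine hz0.congr fun n => ?_
    rw [← huz n, ContinuousLinearMap.comp_apply, ContinuousLinearMap.adjoint_inner_right]
  · rintro ⟨u, hu1, hu2, hlim⟩ c
    have hle (n : ℕ) : ‖A‖ ^ 2 - ‖c * inner 𝕜 (A (u n)) (B (u n))‖ ≤ ‖A‖ * ‖A + c • B‖ := by
      have h1 : ‖inner 𝕜 (A (u n)) ((A + c • B) (u n))‖ ≤ ‖A‖ * ‖A + c • B‖ := by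
        refine (norm_inner_le_norm _ _).trans ?_
        rw [hu2 n]
        gcongr
        simpa [hu1 n] using (A + c • B).le_opNorm (u n)
      have h2 : inner 𝕜 (A (u n)) ((A + c • B) (u n)) =
          ((‖A‖ ^ 2 : ℝ) : 𝕜) + c * inner 𝕜 (A (u n)) (B (u n)) := by
        rw [add_apply, smul_apply, inner_add_right,
          inner_smul_right, inner_self_eq_norm_sq_to_K, hu2 n, RCLike.ofReal_pow]
      have h3 := norm_sub_le_norm_add ((‖A‖ ^ 2 : ℝ) : 𝕜) (c * inner 𝕜 (A (u n)) (B (u n)))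
      rw [RCLike.norm_ofReal, abs_of_nonneg (by positivity), ← h2] at h3
      exact h3.trans h1
    have hl : Tendsto (fun n => ‖A‖ ^ 2 - ‖c * inner 𝕜 (A (u n)) (B (u n))‖) atTop
        (𝓝 (‖A‖ ^ 2)) := by
      simpa using (tendsto_const_nhds (x := ‖A‖ ^ 2)).sub (hlim.const_mul c).norm
    have := le_of_tendsto' hl hle
    rw [sq] at this
    exact le_of_mul_le_mul_left this hApos
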